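/- Let $F_1,F_2,F_3$ be a frame of left-invariant vector fields on $\mathrm{SU}(2)$ with $[F_2,F_3]=-2F_1$, $[F_3,F_1]=-2F_2$, $[F_1,F_2]=-2F_3$ (a Milnor frame), let $\omega^1,\omega^2,\omega^3$ be the dual coframe, and let $g_0=A_0\,\omega^1\otimes\omega^1+B_0\,\omega^2\otimes\omega^2+C_0\,\omega^3\otimes\omega^3$ be a left-invariant Riemannian metric ($A_0,B_0,C_0>0$) with $B_0=C_0$. For a Riemannian metric $g$ on $\mathrm{SU}(2)$ let $$C(g)=\int_{\mathrm{SU}(2)}|C_2|_g\,d\mu_g,\qquad C_{ij}=g_{ik}\varepsilon^{klm}\Bigl(\nabla_lR_{mj}-\tfrac14\nabla_lR\,g_{mj}\Bigr),$$ be the $L^1$-norm of the Cotton–York tensor $C_2=(C_{ij})$, where $\nabla$, $R_{ij}$, $R$, $\varepsilon$ are the Levi-Civita connection, the Ricci tensor, the scalar curvature and the volume tensor of $g$. Then there are a finite $T>0$ and a maximal solution $g(t)$, $0\le t<T$, of the Ricci flow $\partial_t g=-2\,\mathrm{Ric}_g$ with $g(0)=g_0$ consisting of left-invariant metrics (it cannot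 be extended as a Ricci flow beyond $T$); every solution starting at $g_0$ and consisting of left-invariant metrics is a restriction of it, and it has the form $g(t)=A(t)\,\omega^1\otimes\omega^1+B(t)\,(\omega^2\otimes\omega^2+\omega^3\otimes\omega^3)$. Along it: 1. If $A_0/B_0<1/2$, there is exactly one time $t_0\in[0,T)$ with $A(t_0)/B(t_0)=1/2$; one has $t_0>0$, the function $t\mapsto C(g(t))$ has a local extremum at $t_0$ and at no other point of $(0,T)$, and $C(g(t))\to0$ as $t\nearrow T$. 2. If $1/2\le A_0/B_0<1$ or $A_0/B_0>1$, then $t\mapsto C(g(t))$ is strictly decreasing on $[0,T)$ and $C(g(t))\to0$ as $t\nearrow T$. 3. If $A_0=B_0$, then $C(g(t))=0$ for all $t\in[0,T)$. -/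

import Mathlib

open scoped BigOperators Topology ContDiff

noncomputable section

namespace CottonFlow

/-- The group `SU(2)`. -/
abbrev SU2 : Type := Matrix.specialUnitaryGroup (Fin 2) ℂ

/-- The Lie algebra `su(2)` of skew-Hermitian traceless matrices. An element `X` is identified with
the left-invariant vector field `x ↦ x * X` on `SU(2)`. -/
def su2 : Submodule ℝ (Matrix (Fin 2) (Fin 2) ℂ) where
  carrier := {X | X.conjTranspose = -X ∧ X.trace = 0}
  add_mem' := by
    rintro X Y ⟨hX, hX'⟩ ⟨hY, hY'⟩
    refine ⟨?_, ?_⟩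
    · rw [Matrix.conjTranspose_add, hX, hY]; abel
    · rw [Matrix.trace_add, hX', hY', add_zero]
  zero_mem' := by simp
  smul_mem' := by
    rintro c X ⟨hX, hX'⟩
    refine ⟨?_, ?_⟩
    · rw [Matrix.conjTranspose_smul, hX]; simp
    · rw [Matrix.trace_smul, hX', smul_zero]

theorem commutator_mem_su2 (X Y : su2) : X.1 * Y.1 - Y.1 * X.1 ∈ su2 := by
  have hX : X.1.conjTranspose = -X.1 := X.2.1
  have hY : Y.1.conjTranspose = -Y.1 := Y.2.1
  refine ⟨?_, ?_⟩
  · rw [Matrix.conjTranspose_sub, Matrix.conjTranspose_mul, Matrix.conjTranspose_mul, hX, hY]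
    simp
  · rw [Matrix.trace_sub, Matrix.trace_mul_comm X.1 Y.1, sub_self]

/-- The Lie bracket, which for left-invariant vector fields is the commutator of matrices. -/
instance : Bracket su2 su2 := ⟨fun X Y => ⟨X.1 * Y.1 - Y.1 * X.1, commutator_mem_su2 X Y⟩⟩

theorem exp_mem_SU2 (X : su2) :
    NormedSpace.exp (X : Matrix (Fin 2) (Fin 2) ℂ) ∈ Matrix.specialUnitaryGroup (Fin 2) ℂ := by
  obtain ⟨X, hX, hX'⟩ := X
  simp only
  have hinv : NormedSpace.exp X * NormedSpace.exp (-X) = 1 := by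
    rw [← Matrix.exp_add_of_commute _ _ (Commute.neg_right (Commute.refl X)), add_neg_cancel,
      NormedSpace.exp_zero]
  rw [Matrix.mem_specialUnitaryGroup_iff, Matrix.mem_unitaryGroup_iff]
  refine ⟨?_, ?_⟩
  · rw [Matrix.star_eq_conjTranspose, ← Matrix.exp_conjTranspose, hX, hinv]
  · -- for trace-free `X` one has `J * Xᵀ * J⁻¹ = -X`, hence `adjugate (exp X) = exp (-X)`
    set J : Matrix (Fin 2) (Fin 2) ℂ := !![0, 1; -1, 0] with hJ
    have hJdet : IsUnit J := by
      rw [Matrix.isUnit_iff_isUnit_det]; simp [hJ, Matrix.det_fin_two]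
    have hJinv : J⁻¹ = -J := by
      apply Matrix.inv_eq_right_inv
      ext i j; fin_cases i <;> fin_cases j <;> simp [hJ, Matrix.mul_apply, Fin.sum_univ_two]
    have key : ∀ M : Matrix (Fin 2) (Fin 2) ℂ, J * M.transpose * J⁻¹ = M.adjugate := by
      intro M
      rw [hJinv]
      ext i j
      fin_cases i <;> fin_cases j <;>
        simp [hJ, Matrix.mul_apply, Matrix.vecMul, dotProduct, Fin.sum_univ_two,
          Matrix.adjugate_fin_two]
    have hadj : X.adjugate = -X := by
      rw [Matrix.trace_fin_two] at hX'
      ext i j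
      fin_cases i <;> fin_cases j <;> simp [Matrix.adjugate_fin_two]
      · linear_combination hX'
      · linear_combination hX'
    have h1 : NormedSpace.exp (-X) = (NormedSpace.exp X).adjugate := by
      rw [← key, ← Matrix.exp_transpose, ← Matrix.exp_conj _ _ hJdet, key, hadj]
    have h2 := hinv
    rw [h1, Matrix.mul_adjugate] at h2
    have h3 := congrFun (congrFun h2 0) 0
    simpa using h3

/-- The exponential map `su(2) → SU(2)`. -/
def expSU2 (X : su2) : SU2 := ⟨NormedSpace.exp (X : Matrix (Fin 2) (Fin 2) ℂ), exp_mem_SU2 X⟩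

/-- The derivative of `f` along the left-invariant vector field `X`, whose flow is
`x ↦ x * exp (s X)`. -/
def lieDeriv (X : su2) (f : SU2 → ℝ) (x : SU2) : ℝ :=
  deriv (fun s : ℝ => f (x * expSU2 (s • X))) 0

/-- A smooth Riemannian metric on `SU(2)`. The tangent space at `x` is `{x * X | X ∈ su(2)}`, and
`form x X Y` is the inner product of the tangent vectors `x * X` and `x * Y`. Smoothness on the
closed submanifold `SU(2)` of the space of matrices is the existence of a smooth extension. -/
@[ext]
structure RiemannianMetric where
  form : SU2 → LinearMap.BilinForm ℝ su2
  symm : ∀ x X Y, form x X Y = form x Y X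
  pos : ∀ x X, X ≠ 0 → 0 < form x X X
  smooth : ∀ X Y, ∃ f : (Fin 2 → Fin 2 → ℂ) → ℝ, ContDiff ℝ ∞ f ∧
    ∀ x : SU2, form x X Y = f (fun i j => (x : Matrix (Fin 2) (Fin 2) ℂ) i j)

/-- Invariance under left translations: `x * X` is moved by `y` to `(y * x) * X`. -/
def RiemannianMetric.LeftInvariant (g : RiemannianMetric) : Prop :=
  ∀ y x X Y, g.form (y * x) X Y = g.form x X Y

/-- A global frame of left-invariant vector fields. -/
abbrev Frame : Type := Module.Basis (Fin 3) ℝ su2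

/-- `[F₂,F₃] = -2 F₁`, `[F₃,F₁] = -2 F₂`, `[F₁,F₂] = -2 F₃` (indices shifted by one). -/
def Frame.IsMilnor (F : Frame) : Prop :=
  ⁅F 1, F 2⁆ = (-2 : ℝ) • F 0 ∧ ⁅F 2, F 0⁆ = (-2 : ℝ) • F 1 ∧ ⁅F 0, F 1⁆ = (-2 : ℝ) • F 2

/-- `g = a ω¹ ⊗ ω¹ + b ω² ⊗ ω² + c ω³ ⊗ ω³`, where `ω` is the coframe dual to `F`. -/
def RiemannianMetric.IsDiagonal (g : RiemannianMetric) (F : Frame) (a b c : ℝ) : Prop :=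
  ∀ x i j, g.form x (F i) (F j) = Matrix.diagonal ![a, b, c] i j

/-! ### Tensor calculus in the frame `F` -/

section Tensors

variable (F : Frame) (g : RiemannianMetric)

/-- `[F i, F j] = ∑ k, structConst F i j k • F k`. -/
def structConst (i j k : Fin 3) : ℝ := F.repr ⁅F i, F j⁆ k

/-- The components `g_{ij}`. -/
def gram (x : SU2) : Matrix (Fin 3) (Fin 3) ℝ := Matrix.of fun i j => g.form x (F i) (F j)

/-- The components `g^{ij}`. -/
def gramInv (x : SU2) : Matrix (Fin 3) (Fin 3) ℝ := (gram F g x)⁻¹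

/-- `g (∇_{F i} F j, F k)`, with `∇` the Levi-Civita connection, by the Koszul formula. -/
def koszul (i j k : Fin 3) (x : SU2) : ℝ :=
  (1 / 2) * (lieDeriv (F i) (fun y => g.form y (F j) (F k)) x
    + lieDeriv (F j) (fun y => g.form y (F i) (F k)) x
    - lieDeriv (F k) (fun y => g.form y (F i) (F j)) x
    + g.form x ⁅F i, F j⁆ (F k) - g.form x ⁅F i, F k⁆ (F j) - g.form x ⁅F j, F k⁆ (F i))

/-- `∇_{F i} F j = ∑ k, christoffel F g i j k • F k`. -/
def christoffel (i j k : Fin 3) (x : SU2) : ℝ := ∑ l, gramInv F g x k l * koszul F g i j l x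

/-- `R(F i, F j) F k = ∑ l, riemann F g i j k l • F l`, where
`R(X, Y) Z = ∇_X ∇_Y Z - ∇_Y ∇_X Z - ∇_{[X, Y]} Z`. -/
def riemann (i j k l : Fin 3) (x : SU2) : ℝ :=
  lieDeriv (F i) (christoffel F g j k l) x - lieDeriv (F j) (christoffel F g i k l) x
    + ∑ m, (christoffel F g j k m x * christoffel F g i m l x
      - christoffel F g i k m x * christoffel F g j m l x
      - structConst F i j m * christoffel F g m k l x)

/-- The Ricci tensor `R_{jk}`, the trace of `X ↦ R(X, F j) F k`. -/
def ricci (j k : Fin 3) (x : SU2) : ℝ := ∑ i, riemann F g i j k i x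

/-- The scalar curvature. -/
def scalarCurv (x : SU2) : ℝ := ∑ i, ∑ j, gramInv F g x i j * ricci F g i j x

/-- `∇_l R_{mj}`. -/
def nablaRicci (l m j : Fin 3) (x : SU2) : ℝ :=
  lieDeriv (F l) (ricci F g m j) x
    - ∑ p, (christoffel F g l m p x * ricci F g p j x + christoffel F g l j p x * ricci F g m p x)

/-- The totally antisymmetric symbol `η^{klm}` with value `1` at the indices `0, 1, 2`. -/
def eta (k l m : Fin 3) : ℝ :=
  ((l.val : ℝ) - k.val) * ((m.val : ℝ) - l.val) * ((m.val : ℝ) - k.val) / 2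

/-- The Cotton–York tensor
`C_{ij} = g_{ik} ε^{klm} (∇_l R_{mj} - (1/4) ∇_l R g_{mj})`, `ε^{klm} = η^{klm} / √(det g)`. -/
def cottonYork (i j : Fin 3) (x : SU2) : ℝ :=
  ∑ k, ∑ l, ∑ m, gram F g x i k * (eta k l m / √(gram F g x).det) *
    (nablaRicci F g l m j x - (1 / 4) * lieDeriv (F l) (scalarCurv F g) x * gram F g x m j)

/-- The pointwise norm `|C₂|_g = (g^{ip} g^{jq} C_{ij} C_{pq})^{1/2}`. -/
def cottonYorkNorm (x : SU2) : ℝ :=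
  √(∑ i, ∑ j, ∑ p, ∑ q, gramInv F g x i p * gramInv F g x j q *
    cottonYork F g i j x * cottonYork F g p q x)

end Tensors

/-! ### Integration over `SU(2)` -/

/-- The unit sphere `S³` of `ℝ⁴`. -/
abbrev S3 : Type := Metric.sphere (0 : EuclideanSpace ℝ (Fin 4)) 1

/-- The matrix of a point of `ℝ⁴`. -/
def quatMatrix (v : EuclideanSpace ℝ (Fin 4)) : Matrix (Fin 2) (Fin 2) ℂ :=
  !![⟨v 0, v 1⟩, ⟨v 2, v 3⟩; ⟨-v 2, v 3⟩, ⟨v 0, -v 1⟩]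

theorem quatMatrix_mem (p : S3) :
    quatMatrix p.1 ∈ Matrix.specialUnitaryGroup (Fin 2) ℂ := by
  obtain ⟨v, hv⟩ := p
  have h : v 0 ^ 2 + v 1 ^ 2 + v 2 ^ 2 + v 3 ^ 2 = 1 := by
    have h1 : ‖v‖ = 1 := by simpa using hv
    have h2 := EuclideanSpace.norm_sq_eq v
    rw [h1, Fin.sum_univ_four] at h2
    simp only [Real.norm_eq_abs, sq_abs] at h2
    linarith
  rw [Matrix.mem_specialUnitaryGroup_iff, Matrix.mem_unitaryGroup_iff]
  refine ⟨?_, ?_⟩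
  · ext i j
    fin_cases i <;> fin_cases j <;>
      simp [quatMatrix, Matrix.mul_apply, Fin.sum_univ_two, Complex.ext_iff] <;>
      first
        | exact ⟨by linear_combination h, by ring⟩
        | exact ⟨by ring, by ring⟩
  · simp [quatMatrix, Matrix.det_fin_two, Complex.ext_iff]
    exact ⟨by linear_combination h, by ring⟩

/-- The standard identification of `S³` with `SU(2)`. -/
def sphereToSU2 (p : S3) : SU2 := ⟨quatMatrix p.1, quatMatrix_mem p⟩

/-- The round metric on `su(2)`: the one for which `sphereToSU2` is an isometry. -/
def roundInner (X Y : su2) : ℝ :=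
  (1 / 2) * ((X : Matrix (Fin 2) (Fin 2) ℂ) *
    (Y : Matrix (Fin 2) (Fin 2) ℂ).conjTranspose).trace.re

/-- The density of the Riemannian volume `dμ_g` with respect to that of the round metric. -/
def volDensity (F : Frame) (g : RiemannianMetric) (x : SU2) : ℝ :=
  √((gram F g x).det / (Matrix.of fun i j => roundInner (F i) (F j)).det)

/-- The `L¹`-norm `C(g) = ∫ |C₂|_g dμ_g` of the Cotton–York tensor. -/
def cottonL1 (F : Frame) (g : RiemannianMetric) : ℝ :=
  ∫ p : S3, cottonYorkNorm F g (sphereToSU2 p) * volDensity F g (sphereToSU2 p)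
    ∂(MeasureTheory.volume : MeasureTheory.Measure (EuclideanSpace ℝ (Fin 4))).toSphere

/-! ### The Ricci flow -/

/-- `g(t)`, `0 ≤ t < T`, is a smooth family of Riemannian metrics on `SU(2)` that solves
`∂g/∂t = -2 Ric`. -/
structure IsRicciFlow (F : Frame) (T : ℝ) (g : ℝ → RiemannianMetric) : Prop where
  smooth : ∀ X Y, ∃ f : ℝ × (Fin 2 → Fin 2 → ℂ) → ℝ,
    ContDiffOn ℝ ∞ f (Set.Ico 0 T ×ˢ Set.univ) ∧ ∀ t ∈ Set.Ico 0 T, ∀ x : SU2,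
      (g t).form x X Y = f (t, fun i j => (x : Matrix (Fin 2) (Fin 2) ℂ) i j)
  evolution : ∀ t ∈ Set.Ico 0 T, ∀ x i j,
    HasDerivWithinAt (fun s => (g s).form x (F i) (F j)) (-2 * ricci F (g t) i j x)
      (Set.Ico 0 T) t

/-- A Ricci flow on `[0, T)` that is not the restriction of one on a longer interval. -/
def IsMaximalRicciFlow (F : Frame) (T : ℝ) (g : ℝ → RiemannianMetric) : Prop :=
  IsRicciFlow F T g ∧
    ∀ T' > T, ∀ g' : ℝ → RiemannianMetric, IsRicciFlow F T' g' →
      ¬ ∀ t ∈ Set.Ico 0 T, g' t = g t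

end CottonFlow

end

/-!
A diagonal metric in a Milnor frame has constant components, so its Levi-Civita connection, Ricci
tensor and Cotton–York tensor are algebraic in its coefficients. For the Berger metric
`a ω¹ ⊗ ω¹ + b (ω² ⊗ ω² + ω³ ⊗ ω³)` with ratio `r = a / b` they give `C(g) = κ |r (1 - r)|` with a
constant `κ > 0`, and the Ricci flow becomes `A' = -4 r ^ 2`, `B' = -8 + 4 r`. Along it
`(1 - r) / A ^ 2` is constant and `A` decreases to `0` at a finite time `T`, so `r` tends to `1`
monotonically, and `C(g)` follows the graph of `|r (1 - r)|`, whose only maximum below `1` is at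
`r = 1 / 2`. A longer flow would have a degenerate metric at `T`. On left-invariant metrics the
Ricci flow is an ordinary differential equation for the Gram matrix, smooth where the determinant
does not vanish, whence uniqueness.
-/

noncomputable section

namespace CottonFlow

open Set Filter

/-! ### Local extrema of piecewise strictly monotone functions -/

section LocalExtr

variable {α β : Type*} [LinearOrder α] [TopologicalSpace α] [OrderTopology α] [DenselyOrdered α]
  [NoMinOrder α] [NoMaxOrder α] [Preorder β] {f : α → β} {s : Set α} {a b c t : α}

theorem not_isLocalExtr_of_strictMonoOn (hf : StrictMonoOn f s) (hs : s ∈ 𝓝 t) :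
    ¬ IsLocalExtr f t := by
  have ht : t ∈ s := mem_of_mem_nhds hs
  rintro (hmin | hmax)
  · have hleft : ∀ᶠ r in 𝓝[<] t, f t ≤ f r ∧ r ∈ s := nhdsWithin_le_nhds (hmin.and hs)
    obtain ⟨r, ⟨htr, hr⟩, hrt⟩ := (hleft.and self_mem_nhdsWithin).exists
    exact (hf hr ht hrt).not_ge htr
  · have hright : ∀ᶠ r in 𝓝[>] t, f r ≤ f t ∧ r ∈ s := nhdsWithin_le_nhds (hmax.and hs)
    obtain ⟨r, ⟨hrt, hr⟩, htr⟩ := (hright.and self_mem_nhdsWithin).exists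
    exact (hf ht hr htr).not_ge hrt

theorem not_isLocalExtr_of_strictAntiOn (hf : StrictAntiOn f s) (hs : s ∈ 𝓝 t) :
    ¬ IsLocalExtr f t := fun h =>
  not_isLocalExtr_of_strictMonoOn (β := βᵒᵈ) hf.dual_right hs h.symm

theorem isLocalExtr_iff_eq_of_strictMonoOn_of_strictAntiOn (hmono : StrictMonoOn f (Ioc a c))
    (hanti : StrictAntiOn f (Ico c b)) (ht : t ∈ Ioo a b) : IsLocalExtr f t ↔ t = c := by
  refine ⟨fun h => ?_, ?_⟩
  · by_contra hne
    rcases lt_or_gt_of_ne hne with htc | hct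
    · exact not_isLocalExtr_of_strictMonoOn hmono (Ioc_mem_nhds ht.1 htc) h
    · exact not_isLocalExtr_of_strictAntiOn hanti (Ico_mem_nhds hct ht.2) h
  · rintro rfl
    exact (isLocalMax_of_mono_anti ht.1 ht.2 hmono.monotoneOn hanti.antitoneOn).isExtr

end LocalExtr

/-! ### Autonomous ordinary differential equations -/

section ODE

variable {E : Type*} [NormedAddCommGroup E] [NormedSpace ℝ E] {v : E → E} {U : Set E}
  {f g : ℝ → E} {T : ℝ}

theorem locallyLipschitzOn_of_contDiffAt {F : Type*} [NormedAddCommGroup F] [NormedSpace ℝ F]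
    {v : E → F} {K : Set E} (hv : ∀ y ∈ K, ContDiffAt ℝ 1 v y) : LocallyLipschitzOn K v :=
  fun y hy => by
    obtain ⟨C, N, hN, hC⟩ := (hv y hy).exists_lipschitzOnWith
    exact ⟨C, N, mem_nhdsWithin_of_mem_nhds hN, hC⟩

theorem hasDerivWithinAt_Ici_of_Ico {f' : E} {a b t : ℝ} (ht : t ∈ Ico a b)
    (h : HasDerivWithinAt f f' (Ico a b) t) : HasDerivWithinAt f f' (Ici t) t :=
  (h.mono (Ico_subset_Ico_left ht.1)).mono_of_mem_nhdsWithin (Ico_mem_nhdsGE ht.2)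

theorem eqOn_Ico_of_hasDerivWithinAt (hv : ∀ y ∈ U, ContDiffAt ℝ 1 v y)
    (hf : ∀ t ∈ Ico 0 T, HasDerivWithinAt f (v (f t)) (Ico 0 T) t) (hfU : MapsTo f (Ico 0 T) U)
    (hg : ∀ t ∈ Ico 0 T, HasDerivWithinAt g (v (g t)) (Ico 0 T) t) (hgU : MapsTo g (Ico 0 T) U)
    (h0 : f 0 = g 0) : EqOn f g (Ico 0 T) := by
  intro t ht
  have hsub : Icc 0 t ⊆ Ico 0 T := Icc_subset_Ico_right ht.2
  have hsub' : Ico 0 t ⊆ Ico 0 T := Ico_subset_Icc_self.trans hsub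
  have hfc : ContinuousOn f (Icc 0 t) := fun s hs => (hf s (hsub hs)).continuousWithinAt.mono hsub
  have hgc : ContinuousOn g (Icc 0 t) := fun s hs => (hg s (hsub hs)).continuousWithinAt.mono hsub
  have hK : IsCompact (f '' Icc 0 t ∪ g '' Icc 0 t) :=
    (isCompact_Icc.image_of_continuousOn hfc).union (isCompact_Icc.image_of_continuousOn hgc)
  have hKU : f '' Icc 0 t ∪ g '' Icc 0 t ⊆ U :=
    union_subset (hfU.mono_left hsub).image_subset (hgU.mono_left hsub).image_subset
  obtain ⟨C, hC⟩ := (locallyLipschitzOn_of_contDiffAt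
    fun y hy => hv y (hKU hy)).exists_lipschitzOnWith_of_compact hK
  exact ODE_solution_unique_of_mem_Icc_right (v := fun _ => v) (fun _ _ => hC) hfc
    (fun s hs => hasDerivWithinAt_Ici_of_Ico (hsub' hs) (hf s (hsub' hs)))
    (fun s hs => Or.inl (mem_image_of_mem f (Ico_subset_Icc_self hs))) hgc
    (fun s hs => hasDerivWithinAt_Ici_of_Ico (hsub' hs) (hg s (hsub' hs)))
    (fun s hs => Or.inr (mem_image_of_mem g (Ico_subset_Icc_self hs))) h0 (right_mem_Icc.2 ht.1)

theorem contDiffOn_Ico_of_hasDerivWithinAt [CompleteSpace E] {n : ℕ∞} (hv : ContDiffOn ℝ n v U)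
    (hf : ∀ t ∈ Ico 0 T, HasDerivWithinAt f (v (f t)) (Ico 0 T) t)
    (hfU : MapsTo f (Ico 0 T) U) : ContDiffOn ℝ n f (Ico 0 T) := by
  intro t ht
  obtain ⟨s, hts, hsT⟩ := exists_between ht.2
  have hsub : Icc 0 s ⊆ Ico 0 T := Icc_subset_Ico_right hsT
  have hIcc : ContDiffOn ℝ n f (Icc 0 s) :=
    ODE.contDiffOn_enat_Icc_of_hasDerivWithinAt (f := fun _ => v)
      (hv.comp contDiffOn_snd fun _ hp => hp.2) (fun r hr => (hf r (hsub hr)).mono hsub)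
      (hfU.mono_left hsub)
  refine (hIcc t ⟨ht.1, hts.le⟩).mono_of_mem_nhdsWithin ?_
  filter_upwards [self_mem_nhdsWithin, mem_nhdsWithin_of_mem_nhds (Iio_mem_nhds hts)] with r hr hrs
  exact ⟨hr.1, hrs.le⟩

end ODE

section ScalarODE

theorem surjective_of_le_deriv {f : ℝ → ℝ} {m : ℝ} (hm : 0 < m) (hf : Differentiable ℝ f)
    (hf' : ∀ x, m ≤ deriv f x) : Function.Surjective f := by
  have hgrow : ∀ ⦃x y⦄, x ≤ y → m * (y - x) ≤ f y - f x := mul_sub_le_image_sub_of_le_deriv hf hf'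
  refine hf.continuous.surjective ?_ ?_
  · refine tendsto_atTop_mono' _ (f₁ := fun x => m * x + f 0) ?_
      (tendsto_atTop_add_const_right _ _ (tendsto_id.const_mul_atTop hm))
    filter_upwards [eventually_ge_atTop 0] with x hx
    linarith [hgrow hx]
  · refine tendsto_atBot_mono' _ (f₁ := fun x => m * x + f 0) ?_
      (tendsto_atBot_add_const_right _ _ (tendsto_id.const_mul_atBot hm))
    filter_upwards [eventually_le_atBot 0] with x hx
    linarith [hgrow hx]

theorem exists_orderIso_hasDerivAt {ψ : ℝ → ℝ} (hψ : Continuous ψ) {m : ℝ} (hm : 0 < m)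
    (hmψ : ∀ x, m ≤ ψ x) (a : ℝ) : ∃ e : ℝ ≃o ℝ, e a = 0 ∧ ∀ x, HasDerivAt e (ψ x) x := by
  set τ : ℝ → ℝ := fun x => ∫ s in a..x, ψ s
  have hτ : ∀ x, HasDerivAt τ (ψ x) x := fun x => hψ.integral_hasStrictDerivAt a x |>.hasDerivAt
  have hmono : StrictMono τ := strictMono_of_deriv_pos fun x =>
    (hτ x).deriv.symm ▸ hm.trans_le (hmψ x)
  have hsurj : Function.Surjective τ := surjective_of_le_deriv hm
    (fun x => (hτ x).differentiableAt) fun x => (hτ x).deriv.symm ▸ hmψ x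
  exact ⟨hmono.orderIsoOfSurjective τ hsurj, intervalIntegral.integral_same, hτ⟩

/-- Separation of variables: the solution is the inverse function of `x ↦ ∫ s in a..x, (φ s)⁻¹`. -/
theorem exists_strictMono_hasDerivAt {φ : ℝ → ℝ} {a b : ℝ} (hab : a < b)
    (hφ : ContinuousOn φ (Icc a b)) (hpos : ∀ s ∈ Icc a b, 0 < φ s) :
    ∃ T > 0, ∃ y : ℝ → ℝ, y 0 = a ∧ y T = b ∧ StrictMono y ∧
      ∀ t ∈ Icc 0 T, HasDerivAt y (φ (y t)) t := by
  set ψ : ℝ → ℝ := IccExtend hab.le ((Icc a b).domRestrict fun s => (φ s)⁻¹)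
  have hinv : ContinuousOn (fun s => (φ s)⁻¹) (Icc a b) := hφ.inv₀ fun s hs => (hpos s hs).ne'
  obtain ⟨s₀, hs₀, hmin⟩ := isCompact_Icc.exists_isMinOn (nonempty_Icc.2 hab.le) hinv
  obtain ⟨e, hea, he⟩ := exists_orderIso_hasDerivAt (ψ := ψ) hinv.domRestrict.Icc_extend'
    (inv_pos.2 (hpos s₀ hs₀)) (fun x => hmin (projIcc a b hab.le x).2) a
  have hsymm : ∀ t, HasDerivAt e.symm (ψ (e.symm t))⁻¹ t := fun t =>
    HasDerivAt.of_local_left_inverse e.symm.continuous.continuousAt (he (e.symm t))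
      (inv_pos.2 (hpos _ (projIcc a b hab.le _).2)).ne' (.of_forall e.apply_symm_apply)
  refine ⟨e b, hea ▸ e.strictMono hab, e.symm, ?_, e.symm_apply_apply b, e.symm.strictMono,
    fun t ht => ?_⟩
  · rw [← hea, e.symm_apply_apply]
  · have hmem : e.symm t ∈ Icc a b :=
      ⟨e.le_symm_apply.2 (hea ▸ ht.1), e.symm_apply_le.2 ht.2⟩
    have hψ : ψ (e.symm t) = (φ (e.symm t))⁻¹ := IccExtend_of_mem _ _ hmem
    simpa only [hψ, inv_inv] using hsymm t

end ScalarODE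

/-! ### Smoothness of the matrix inverse -/

section MatrixSmooth

variable {𝕜 ι : Type*} [NontriviallyNormedField 𝕜] [Fintype ι] [DecidableEq ι] {n : WithTop ℕ∞}

theorem contDiff_det : ContDiff 𝕜 n fun M : ι → ι → 𝕜 => (Matrix.of M).det := by
  simp only [Matrix.det_apply, Matrix.of_apply]
  fun_prop

theorem contDiff_adjugate_apply (i j : ι) :
    ContDiff 𝕜 n fun M : ι → ι → 𝕜 => (Matrix.of M).adjugate i j := by
  have hupdate : ContDiff 𝕜 n fun M : ι → ι → 𝕜 => Function.update M j (Pi.single i 1) := by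
    refine contDiff_pi.2 fun k => ?_
    obtain rfl | hk := eq_or_ne k j
    · simp only [Function.update_self]
      exact contDiff_const
    · simp only [Function.update_of_ne hk]
      fun_prop
  simp only [Matrix.adjugate_apply]
  exact contDiff_det.comp hupdate

theorem contDiffAt_inv_apply {M : ι → ι → 𝕜} (hM : (Matrix.of M).det ≠ 0) (i j : ι) :
    ContDiffAt 𝕜 n (fun N : ι → ι → 𝕜 => (Matrix.of N)⁻¹ i j) M := by
  have hdet : ContDiffAt 𝕜 n (fun N : ι → ι → 𝕜 => (Matrix.of N).det) M := contDiff_det.contDiffAt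
  simp only [Matrix.inv_def, Ring.inverse_eq_inv', Matrix.smul_apply, smul_eq_mul]
  exact (hdet.inv hM).mul (contDiff_adjugate_apply i j).contDiffAt

end MatrixSmooth

/-! ### Curvature of left-invariant metrics -/

section Algebraic

variable {ι : Type*} [Fintype ι] [DecidableEq ι] (c : ι → ι → ι → ℝ) (G : Matrix ι ι ℝ)

/-- `g (∇_{F i} F j, F k)` for the left-invariant metric with Gram matrix `G` in a left-invariant
frame `F` with structure constants `c`. -/
def leftInvKoszul (i j k : ι) : ℝ :=
  (1 / 2) * (∑ m, c i j m * G m k - ∑ m, c i k m * G m j - ∑ m, c j k m * G m i)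

/-- The `k`-th component of `∇_{F i} F j` for the left-invariant metric with Gram matrix `G`. -/
def leftInvChristoffel (i j k : ι) : ℝ := ∑ l, G⁻¹ k l * leftInvKoszul c G i j l

/-- The components of the Ricci tensor of the left-invariant metric with Gram matrix `G`. -/
def leftInvRicci (j k : ι) : ℝ :=
  ∑ i, ∑ m, (leftInvChristoffel c G j k m * leftInvChristoffel c G i m i
    - leftInvChristoffel c G i k m * leftInvChristoffel c G j m i
    - c i j m * leftInvChristoffel c G m k i)

variable {n : WithTop ℕ∞} {G : ι → ι → ℝ}

theorem contDiffAt_leftInvChristoffel (hG : (Matrix.of G).det ≠ 0) (i j k : ι) :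
    ContDiffAt ℝ n (fun H => leftInvChristoffel c (Matrix.of H) i j k) G := by
  refine ContDiffAt.sum fun l _ => (contDiffAt_inv_apply hG k l).mul ?_
  simp only [leftInvKoszul, Matrix.of_apply]
  fun_prop

theorem contDiffAt_leftInvRicci (hG : (Matrix.of G).det ≠ 0) (j k : ι) :
    ContDiffAt ℝ n (fun H => leftInvRicci c (Matrix.of H) j k) G :=
  have hΓ := contDiffAt_leftInvChristoffel (n := n) c hG
  ContDiffAt.sum fun i _ => ContDiffAt.sum fun m _ =>
    (((hΓ j k m).mul (hΓ i m i)).sub ((hΓ i k m).mul (hΓ j m i))).sub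
      (contDiffAt_const.mul (hΓ m k i))

end Algebraic

theorem lieDeriv_const (X : su2) (c : ℝ) (x : SU2) : lieDeriv X (fun _ => c) x = 0 :=
  deriv_const 0 c

section Gram

variable (F : Frame) (g : RiemannianMetric)

theorem gram_eq_toMatrix (x : SU2) : gram F g x = LinearMap.BilinForm.toMatrix F (g.form x) := by
  ext i j
  simp [gram]

theorem form_eq_sum (x : SU2) (X Y : su2) :
    g.form x X Y = ∑ i, ∑ j, F.repr X i * gram F g x i j * F.repr Y j := by
  rw [gram_eq_toMatrix, ← Matrix.toBilin_apply, Matrix.toBilin_toMatrix]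

theorem form_bracket (x : SU2) (i j k : Fin 3) :
    g.form x ⁅F i, F j⁆ (F k) = ∑ m, structConst F i j m * gram F g x m k := by
  simp [form_eq_sum F, structConst, Finsupp.single_apply]

theorem posDef_gram (x : SU2) : (gram F g x).PosDef := by
  rw [gram_eq_toMatrix, ← LinearMap.BilinForm.posDef_toQuadraticMap_iff_matrix F _ ⟨g.symm x⟩]
  exact g.pos x

variable {F g} in
theorem RiemannianMetric.ext_gram {g' : RiemannianMetric} (h : gram F g = gram F g') : g = g' := by
  ext x X Y
  rw [form_eq_sum F, form_eq_sum F, h]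

theorem exists_gram_eq {G : Matrix (Fin 3) (Fin 3) ℝ} (hG : G.PosDef) :
    ∃ g, gram F g = fun _ => G := by
  have hsymm : (Matrix.toBilin F G).IsSymm :=
    (Matrix.isSymm_toBilin_iff_isSymm F).2 (Matrix.isHermitian_iff_isSymm.1 hG.isHermitian)
  refine ⟨⟨fun _ => Matrix.toBilin F G, fun _ => hsymm.eq, fun _ => ?_,
    fun X Y => ⟨_, contDiff_const, fun _ => rfl⟩⟩, ?_⟩
  · refine (LinearMap.BilinForm.posDef_toQuadraticMap_iff_matrix F _ hsymm).2 ?_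
    rwa [LinearMap.BilinForm.toMatrix_toBilin]
  · funext x
    rw [gram_eq_toMatrix, LinearMap.BilinForm.toMatrix_toBilin]

end Gram

section LeftInvariant

variable {g : RiemannianMetric} (hg : g.LeftInvariant)
include hg

theorem RiemannianMetric.LeftInvariant.form_eq (x : SU2) : g.form x = g.form 1 := by
  ext X Y
  simpa only [mul_one] using hg x 1 X Y

variable (F : Frame)

theorem RiemannianMetric.LeftInvariant.gram_eq (x : SU2) : gram F g x = gram F g 1 := by
  simp only [gram, hg.form_eq x]

theorem RiemannianMetric.LeftInvariant.koszul_eq (i j k : Fin 3) (x : SU2) :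
    koszul F g i j k x = leftInvKoszul (structConst F) (gram F g 1) i j k := by
  have hconst : ∀ X Y, (fun y => g.form y X Y) = fun _ => g.form 1 X Y := fun X Y =>
    funext fun y => by rw [hg.form_eq y]
  simp only [koszul, leftInvKoszul, hconst, lieDeriv_const, form_bracket, hg.gram_eq F x, zero_add,
    sub_zero]

theorem RiemannianMetric.LeftInvariant.christoffel_eq (i j k : Fin 3) :
    christoffel F g i j k = fun _ => leftInvChristoffel (structConst F) (gram F g 1) i j k := by
  funext x
  simp only [christoffel, leftInvChristoffel, gramInv, hg.koszul_eq F, hg.gram_eq F x]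

theorem RiemannianMetric.LeftInvariant.ricci_eq (j k : Fin 3) :
    ricci F g j k = fun _ => leftInvRicci (structConst F) (gram F g 1) j k := by
  funext x
  simp only [ricci, riemann, leftInvRicci, hg.christoffel_eq F, lieDeriv_const, sub_self, zero_add]

theorem RiemannianMetric.LeftInvariant.lieDeriv_scalarCurv (X : su2) (x : SU2) :
    lieDeriv X (scalarCurv F g) x = 0 := by
  have hconst : scalarCurv F g = fun _ => scalarCurv F g 1 := funext fun y => by
    simp only [scalarCurv, hg.ricci_eq F, gramInv, hg.gram_eq F y]
  rw [hconst, lieDeriv_const]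

theorem RiemannianMetric.LeftInvariant.nablaRicci_eq (l m j : Fin 3) (x : SU2) :
    nablaRicci F g l m j x = -∑ p, (christoffel F g l m p x * ricci F g p j x
      + christoffel F g l j p x * ricci F g m p x) := by
  simp only [nablaRicci, hg.ricci_eq F, lieDeriv_const, zero_sub]

end LeftInvariant

/-! ### The Ricci flow of left-invariant metrics -/

/-- The vector field `-2 Ric` on Gram matrices, whose integral curves are the Ricci flows of
left-invariant metrics. It is a function on `ι → ι → ℝ`, which carries a norm, unlike `Matrix`. -/
def ricciFlowField {ι : Type*} [Fintype ι] [DecidableEq ι] (c : ι → ι → ι → ℝ) (G : ι → ι → ℝ) :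
    ι → ι → ℝ :=
  fun i j => -2 * leftInvRicci c (Matrix.of G) i j

theorem contDiffAt_ricciFlowField {ι : Type*} [Fintype ι] [DecidableEq ι] (c : ι → ι → ι → ℝ)
    {n : WithTop ℕ∞} {G : ι → ι → ℝ} (hG : (Matrix.of G).det ≠ 0) :
    ContDiffAt ℝ n (ricciFlowField c) G :=
  contDiffAt_pi.2 fun i => contDiffAt_pi.2 fun j =>
    contDiffAt_const.mul (contDiffAt_leftInvRicci c hG i j)

section RicciFlow

variable {F : Frame} {T T' : ℝ} {g g' : ℝ → RiemannianMetric}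

theorem hasDerivWithinAt_gram {S : Set ℝ} {t : ℝ} (hg : (g t).LeftInvariant)
    (h : ∀ i j, HasDerivWithinAt (fun s => gram F (g s) 1 i j) (-2 * ricci F (g t) i j 1) S t) :
    HasDerivWithinAt (fun s => (gram F (g s) 1 : Fin 3 → Fin 3 → ℝ))
      (ricciFlowField (structConst F) (gram F (g t) 1)) S t := by
  refine hasDerivWithinAt_pi.2 fun i => hasDerivWithinAt_pi.2 fun j => ?_
  have hij := h i j
  rwa [hg.ricci_eq F] at hij

theorem contDiffOn_gram (hg : ∀ t ∈ Ico 0 T, (g t).LeftInvariant)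
    (h : ∀ t ∈ Ico 0 T, ∀ i j, HasDerivWithinAt (fun s => gram F (g s) 1 i j)
      (-2 * ricci F (g t) i j 1) (Ico 0 T) t) (i j : Fin 3) :
    ContDiffOn ℝ ∞ (fun t => gram F (g t) 1 i j) (Ico 0 T) := by
  have hgram : ContDiffOn ℝ ∞ (F := Fin 3 → Fin 3 → ℝ) (fun t => gram F (g t) 1) (Ico 0 T) :=
    contDiffOn_Ico_of_hasDerivWithinAt (U := {G | (Matrix.of G).det ≠ 0})
      (fun G hG => (contDiffAt_ricciFlowField (structConst F) hG).contDiffWithinAt)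
      (fun t ht => hasDerivWithinAt_gram (hg t ht) (h t ht))
      fun t _ => (posDef_gram F (g t) 1).det_pos.ne'
  exact contDiffOn_pi.1 (contDiffOn_pi.1 hgram i) j

theorem isRicciFlow_of_leftInvariant (hg : ∀ t ∈ Ico 0 T, (g t).LeftInvariant)
    (h : ∀ t ∈ Ico 0 T, ∀ i j, HasDerivWithinAt (fun s => gram F (g s) 1 i j)
      (-2 * ricci F (g t) i j 1) (Ico 0 T) t) : IsRicciFlow F T g where
  smooth X Y := by
    refine ⟨fun p => ∑ i, ∑ j, F.repr X i * gram F (g p.1) 1 i j * F.repr Y j, ?_,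
      fun t ht x => by rw [form_eq_sum F, (hg t ht).gram_eq F x]⟩
    exact ContDiffOn.sum fun i _ => ContDiffOn.sum fun j _ =>
      (contDiffOn_const.mul ((contDiffOn_gram hg h i j).comp contDiffOn_fst fun p hp => hp.1)).mul
        contDiffOn_const
  evolution t ht x i j := by
    have hform : ∀ s ∈ Ico 0 T, (g s).form x (F i) (F j) = gram F (g s) 1 i j := fun s hs => by
      rw [(hg s hs).form_eq x, gram, Matrix.of_apply]
    rw [show ricci F (g t) i j x = ricci F (g t) i j 1 by rw [(hg t ht).ricci_eq F]]
    exact (h t ht i j).congr hform (hform t ht)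

theorem IsRicciFlow.mono (hg : IsRicciFlow F T g) (h : T' ≤ T) : IsRicciFlow F T' g where
  smooth X Y := by
    obtain ⟨f, hf, hfg⟩ := hg.smooth X Y
    have hsub : Ico 0 T' ⊆ Ico 0 T := Ico_subset_Ico_right h
    exact ⟨f, hf.mono (prod_mono hsub subset_rfl), fun t ht => hfg t (hsub ht)⟩
  evolution t ht x i j :=
    (hg.evolution t (Ico_subset_Ico_right h ht) x i j).mono (Ico_subset_Ico_right h)

theorem IsRicciFlow.continuousOn_form (hg : IsRicciFlow F T g) (x : SU2) (X Y : su2) :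
    ContinuousOn (fun t => (g t).form x X Y) (Ico 0 T) := by
  obtain ⟨f, hf, hfg⟩ := hg.smooth X Y
  exact (hf.continuousOn.comp (f := fun t => (t, fun i j => x.1 i j)) (by fun_prop)
    fun t ht => ⟨ht, mem_univ _⟩).congr fun t ht => hfg t ht x

theorem IsRicciFlow.eqOn_of_leftInvariant (hg : IsRicciFlow F T g)
    (hinv : ∀ t ∈ Ico 0 T, (g t).LeftInvariant) (hg' : IsRicciFlow F T g')
    (hinv' : ∀ t ∈ Ico 0 T, (g' t).LeftInvariant) (h0 : g 0 = g' 0) : EqOn g g' (Ico 0 T) := by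
  have hgram : EqOn (fun t => (gram F (g t) 1 : Fin 3 → Fin 3 → ℝ)) (fun t => gram F (g' t) 1)
      (Ico 0 T) :=
    eqOn_Ico_of_hasDerivWithinAt (U := {G | (Matrix.of G).det ≠ 0})
      (fun G hG => contDiffAt_ricciFlowField (structConst F) hG)
      (fun t ht => hasDerivWithinAt_gram (hinv t ht) (hg.evolution t ht 1))
      (fun t _ => (posDef_gram F (g t) 1).det_pos.ne')
      (fun t ht => hasDerivWithinAt_gram (hinv' t ht) (hg'.evolution t ht 1))
      (fun t _ => (posDef_gram F (g' t) 1).det_pos.ne') (by rw [h0])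
  intro t ht
  refine RiemannianMetric.ext_gram (F := F) (funext fun x => ?_)
  rw [(hinv t ht).gram_eq F x, (hinv' t ht).gram_eq F x]
  exact hgram ht

theorem IsRicciFlow.isMaximalRicciFlow_of_tendsto_zero (hg : IsRicciFlow F T g) (hT : 0 < T)
    {x : SU2} {X : su2} (hX : X ≠ 0)
    (hlim : Tendsto (fun t => (g t).form x X X) (𝓝[<] T) (𝓝 0)) : IsMaximalRicciFlow F T g := by
  refine ⟨hg, fun T' hT' g' hg' heq => ((g' T).pos x X hX).ne' ?_⟩
  have hle : 𝓝[<] T ≤ 𝓝[Ico 0 T'] T :=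
    nhdsWithin_le_of_mem (mem_of_superset (Ico_mem_nhdsLT hT) (Ico_subset_Ico_right hT'.le))
  have hlim' : Tendsto (fun t => (g' t).form x X X) (𝓝[<] T) (𝓝 ((g' T).form x X X)) :=
    (hg'.continuousOn_form x X X T ⟨hT.le, hT'⟩).mono_left hle
  refine tendsto_nhds_unique (hlim'.congr' ?_) hlim
  filter_upwards [Ico_mem_nhdsLT hT] with t ht
  rw [heq t ht]

theorem IsMaximalRicciFlow.le_and_eqOn_of_leftInvariant (hg : IsMaximalRicciFlow F T g)
    (hinv : ∀ t ∈ Ico 0 T, (g t).LeftInvariant) (hg' : IsRicciFlow F T' g')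
    (hinv' : ∀ t ∈ Ico 0 T', (g' t).LeftInvariant) (h0 : g' 0 = g 0) :
    T' ≤ T ∧ EqOn g' g (Ico 0 T') := by
  have hagree : ∀ S ≤ T, S ≤ T' → EqOn g' g (Ico 0 S) := fun S hS hS' =>
    (hg'.mono hS').eqOn_of_leftInvariant (fun t ht => hinv' t (Ico_subset_Ico_right hS' ht))
      (hg.1.mono hS) (fun t ht => hinv t (Ico_subset_Ico_right hS ht)) h0
  have hle : T' ≤ T := not_lt.1 fun hlt => hg.2 T' hlt g' hg' (hagree T le_rfl hlt.le)
  exact ⟨hle, hagree T' hle le_rfl⟩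

end RicciFlow

/-! ### Diagonal metrics in a Milnor frame -/

theorem bracket_self (X : su2) : ⁅X, X⁆ = 0 :=
  Subtype.ext (sub_self _)

theorem neg_bracket (X Y : su2) : -⁅X, Y⁆ = ⁅Y, X⁆ :=
  Subtype.ext (neg_sub _ _)

theorem Frame.IsMilnor.structConst_eq {F : Frame} (hF : F.IsMilnor) :
    structConst F = fun i j k => -2 * eta i j k := by
  obtain ⟨h₁₂, h₂₀, h₀₁⟩ := hF
  have h₂₁ := (neg_bracket (F 1) (F 2)).symm
  have h₀₂ := (neg_bracket (F 2) (F 0)).symm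
  have h₁₀ := (neg_bracket (F 0) (F 1)).symm
  rw [h₁₂] at h₂₁
  rw [h₂₀] at h₀₂
  rw [h₀₁] at h₁₀
  funext i j k
  fin_cases i <;> fin_cases j <;> fin_cases k <;>
    simp [structConst, eta, bracket_self, h₁₂, h₂₀, h₀₁, h₂₁, h₀₂, h₁₀] <;> norm_num

theorem inv_diagonal_of_ne_zero {ι 𝕜 : Type*} [Fintype ι] [DecidableEq ι] [Field 𝕜] {d : ι → 𝕜}
    (hd : ∀ i, d i ≠ 0) : (Matrix.diagonal d)⁻¹ = Matrix.diagonal fun i => (d i)⁻¹ := by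
  refine Matrix.inv_eq_right_inv ?_
  simp only [Matrix.diagonal_mul_diagonal, mul_inv_cancel₀ (hd _), Matrix.diagonal_one]

section Diagonal

variable {d : Fin 3 → ℝ} (hd : ∀ i, d i ≠ 0)
include hd

theorem leftInvChristoffel_diagonal (i j k : Fin 3) :
    leftInvChristoffel (fun i j k => -2 * eta i j k) (Matrix.diagonal d) i j k =
      eta i j k * ((d i - d j - d k) / d k) := by
  have hkoszul : leftInvKoszul (fun i j k => -2 * eta i j k) (Matrix.diagonal d) i j k =
      eta i j k * (d i - d j - d k) := by
    fin_cases i <;> fin_cases j <;> fin_cases k <;>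
      simp [leftInvKoszul, eta, Matrix.diagonal] <;> ring
  rw [leftInvChristoffel, inv_diagonal_of_ne_zero hd]
  simp only [Matrix.diagonal_apply, ite_mul, zero_mul, Finset.sum_ite_eq, Finset.mem_univ, if_true,
    hkoszul]
  ring

theorem leftInvRicci_diagonal (i j : Fin 3) :
    leftInvRicci (fun i j k => -2 * eta i j k) (Matrix.diagonal d) i j =
      Matrix.diagonal
        (fun i => 2 * (d i ^ 2 - (d (i + 1) - d (i + 2)) ^ 2) / (d (i + 1) * d (i + 2))) i j := by
  have h₀ := hd 0
  have h₁ := hd 1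
  have h₂ := hd 2
  simp only [leftInvRicci, leftInvChristoffel_diagonal hd]
  fin_cases i <;> fin_cases j <;>
    simp [eta, Fin.sum_univ_three, Matrix.diagonal] <;> field_simp <;> ring

end Diagonal

namespace RiemannianMetric.IsDiagonal

variable {F : Frame} {g g' : RiemannianMetric} {a b c : ℝ}

theorem gram_eq (hg : g.IsDiagonal F a b c) (x : SU2) :
    gram F g x = Matrix.diagonal ![a, b, c] :=
  Matrix.ext (hg x)

theorem eq (hg : g.IsDiagonal F a b c) (hg' : g'.IsDiagonal F a b c) : g = g' :=
  ext_gram (funext fun x => by rw [hg.gram_eq, hg'.gram_eq])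

theorem leftInvariant (hg : g.IsDiagonal F a b c) : g.LeftInvariant := fun y x X Y => by
  simp only [form_eq_sum F, hg.gram_eq]

theorem pos (hg : g.IsDiagonal F a b c) (i : Fin 3) : 0 < ![a, b, c] i :=
  Matrix.posDef_diagonal_iff.1 (hg.gram_eq 1 ▸ posDef_gram F g 1) i

theorem fst_pos (hg : g.IsDiagonal F a b c) : 0 < a := hg.pos 0

theorem snd_pos (hg : g.IsDiagonal F a b c) : 0 < b := hg.pos 1

theorem christoffel_eq (hF : F.IsMilnor) (hg : g.IsDiagonal F a b c) (i j k : Fin 3) (x : SU2) :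
    christoffel F g i j k x =
      eta i j k * ((![a, b, c] i - ![a, b, c] j - ![a, b, c] k) / ![a, b, c] k) := by
  rw [hg.leftInvariant.christoffel_eq F, hF.structConst_eq, hg.gram_eq,
    leftInvChristoffel_diagonal fun i => (hg.pos i).ne']

end RiemannianMetric.IsDiagonal

theorem exists_isDiagonal (F : Frame) {a b c : ℝ} (ha : 0 < a) (hb : 0 < b) (hc : 0 < c) :
    ∃ g : RiemannianMetric, g.IsDiagonal F a b c := by
  have hpos : ∀ i, 0 < ![a, b, c] i := by
    simp [Fin.forall_fin_succ, ha, hb, hc]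
  obtain ⟨g, hg⟩ := exists_gram_eq F (Matrix.PosDef.diagonal hpos)
  exact ⟨g, fun x i j => congrFun₂ (congrFun hg x) i j⟩

/-! ### Berger metrics -/

namespace RiemannianMetric.IsDiagonal

variable {F : Frame} {g : RiemannianMetric} {a b : ℝ}

theorem ricci_eq (hF : F.IsMilnor) (hg : g.IsDiagonal F a b b) (i j : Fin 3) (x : SU2) :
    ricci F g i j x =
      Matrix.diagonal ![2 * (a / b) ^ 2, 4 - 2 * (a / b), 4 - 2 * (a / b)] i j := by
  have ha := hg.fst_pos.ne'
  have hb := hg.snd_pos.ne'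
  rw [hg.leftInvariant.ricci_eq F, hF.structConst_eq, hg.gram_eq,
    leftInvRicci_diagonal fun i => (hg.pos i).ne']
  beta_reduce
  congr 2
  funext i
  fin_cases i <;> simp <;> field_simp <;> ring

theorem nablaRicci_eq (hF : F.IsMilnor) (hg : g.IsDiagonal F a b b) (l m j : Fin 3) (x : SU2) :
    nablaRicci F g l m j x = 4 * (a / b) * (1 - a / b) *
      ![0, !![0, 0, -1; 0, 0, 0; -1, 0, 0], !![0, 1, 0; 1, 0, 0; 0, 0, 0]] l m j := by
  have ha := hg.fst_pos.ne'
  have hb := hg.snd_pos.ne'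
  rw [hg.leftInvariant.nablaRicci_eq F]
  simp only [hg.christoffel_eq hF, hg.ricci_eq hF]
  fin_cases l <;> fin_cases m <;> fin_cases j <;>
    simp [eta, Fin.sum_univ_three, Matrix.diagonal] <;> field_simp <;> ring

theorem det_gram (hg : g.IsDiagonal F a b b) (x : SU2) : (gram F g x).det = a * b ^ 2 := by
  simp [hg.gram_eq, Matrix.det_diagonal, Fin.prod_univ_three, mul_assoc, pow_two]

theorem cottonYork_eq (hF : F.IsMilnor) (hg : g.IsDiagonal F a b b) (i j : Fin 3) (x : SU2) :
    cottonYork F g i j x =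
      4 * (a / b) * (1 - a / b) / √(a * b ^ 2) * Matrix.diagonal ![-2 * a, b, b] i j := by
  simp only [cottonYork, hg.nablaRicci_eq hF, hg.det_gram, hg.leftInvariant.lieDeriv_scalarCurv F]
  simp only [hg.gram_eq]
  fin_cases i <;> fin_cases j <;>
    simp [eta, Fin.sum_univ_three, Matrix.diagonal] <;> ring

theorem cottonYorkNorm_eq (hF : F.IsMilnor) (hg : g.IsDiagonal F a b b) (x : SU2) :
    cottonYorkNorm F g x = 4 * √6 * |a / b * (1 - a / b)| / √(a * b ^ 2) := by
  have ha := hg.fst_pos.ne'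
  have hb := hg.snd_pos.ne'
  have hsq : ∑ i, ∑ j, ∑ p, ∑ q, gramInv F g x i p * gramInv F g x j q *
      cottonYork F g i j x * cottonYork F g p q x =
        6 * (4 * (a / b * (1 - a / b)) / √(a * b ^ 2)) ^ 2 := by
    simp only [gramInv, hg.gram_eq, inv_diagonal_of_ne_zero fun i => (hg.pos i).ne',
      hg.cottonYork_eq hF]
    generalize √(a * b ^ 2) = v
    simp [Fin.sum_univ_three, Matrix.diagonal]
    field_simp
    ring
  rw [cottonYorkNorm, hsq, Real.sqrt_mul (by norm_num), Real.sqrt_sq_eq_abs, abs_div, abs_mul,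
    Nat.abs_ofNat, abs_of_nonneg (Real.sqrt_nonneg _)]
  ring

end RiemannianMetric.IsDiagonal

/-! ### The total Cotton–York norm of a Berger metric -/

/-- The round metric on `su(2)` as a bilinear form. -/
def roundForm : LinearMap.BilinForm ℝ su2 :=
  LinearMap.mk₂ ℝ roundInner
    (fun X X' Y => by simp [roundInner, add_mul, mul_add])
    (fun s X Y => by simp [roundInner, mul_left_comm])
    (fun X Y Y' => by simp [roundInner, mul_add])
    (fun s X Y => by simp [roundInner, mul_left_comm])

theorem roundForm_isSymm : roundForm.IsSymm where
  eq X Y := by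
    have h : ((X.1 * Y.1.conjTranspose).conjTranspose).trace.re =
        (X.1 * Y.1.conjTranspose).trace.re := by
      rw [Matrix.trace_conjTranspose, Complex.star_def, Complex.conj_re]
    rw [Matrix.conjTranspose_mul, Matrix.conjTranspose_conjTranspose] at h
    simp [roundForm, roundInner, h]

open scoped ComplexOrder in
theorem roundForm_posDef : roundForm.toQuadraticMap.PosDef := by
  intro X hX
  have hpsd := (Matrix.posSemidef_self_mul_conjTranspose X.1).trace_nonneg
  have hne : (X.1 * X.1.conjTranspose).trace ≠ 0 := by
    rwa [Ne, Matrix.trace_mul_conjTranspose_self_eq_zero_iff, ZeroMemClass.coe_eq_zero]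
  have hpos := (Complex.pos_iff.1 (hpsd.lt_of_ne' hne)).1
  simpa [roundForm, roundInner] using hpos

theorem det_roundInner_pos (F : Frame) :
    0 < (Matrix.of fun i j => roundInner (F i) (F j)).det := by
  have hmatrix : (Matrix.of fun i j => roundInner (F i) (F j)) =
      LinearMap.BilinForm.toMatrix F roundForm := by
    ext i j
    simp [roundForm]
  rw [hmatrix]
  exact ((LinearMap.BilinForm.posDef_toQuadraticMap_iff_matrix F roundForm roundForm_isSymm).1
    roundForm_posDef).det_pos

/-- The factor by which `cottonL1` differs from `|r (1 - r)|` on Berger metrics with ratio `r`;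
besides the volume of the unit sphere, it compensates for the round volume of the frame. -/
def cottonConst (F : Frame) : ℝ :=
  (MeasureTheory.volume : MeasureTheory.Measure (EuclideanSpace ℝ (Fin 4))).toSphere.real univ *
    (4 * √6 / √(Matrix.of fun i j => roundInner (F i) (F j)).det)

theorem cottonConst_pos (F : Frame) : 0 < cottonConst F := by
  have hdet := Real.sqrt_pos.2 (det_roundInner_pos F)
  have : NeZero (MeasureTheory.volume :
      MeasureTheory.Measure (EuclideanSpace ℝ (Fin 4))).toSphere :=
    ⟨MeasureTheory.Measure.toSphere_ne_zero _⟩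
  exact mul_pos MeasureTheory.measureReal_univ_pos (by positivity)

/-- The total Cotton–York norm of the Berger metrics `a ω¹ ⊗ ω¹ + b (ω² ⊗ ω² + ω³ ⊗ ω³)` with
`a / b = r`, as a function of `r`. -/
def bergerCotton (F : Frame) (r : ℝ) : ℝ := cottonConst F * |r * (1 - r)|

theorem RiemannianMetric.IsDiagonal.cottonL1_eq {F : Frame} {g : RiemannianMetric} {a b : ℝ}
    (hF : F.IsMilnor) (hg : g.IsDiagonal F a b b) : cottonL1 F g = bergerCotton F (a / b) := by
  have ha := hg.fst_pos
  have hb := hg.snd_pos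
  have hvol : √(a * b ^ 2) ≠ 0 := by positivity
  have hround := (Real.sqrt_pos.2 (det_roundInner_pos F)).ne'
  simp only [cottonL1, hg.cottonYorkNorm_eq hF, volDensity, hg.det_gram,
    MeasureTheory.integral_const, smul_eq_mul, bergerCotton, cottonConst]
  rw [Real.sqrt_div (by positivity)]
  field_simp

section BergerCotton

variable (F : Frame)

theorem bergerCotton_one : bergerCotton F 1 = 0 := by simp [bergerCotton]

theorem continuous_bergerCotton : Continuous (bergerCotton F) := by
  unfold bergerCotton
  fun_prop

theorem strictMonoOn_bergerCotton_Icc_zero_half :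
    StrictMonoOn (bergerCotton F) (Icc 0 (1 / 2)) := by
  intro r hr s hs hrs
  refine mul_lt_mul_of_pos_left ?_ (cottonConst_pos F)
  rw [abs_of_nonneg (mul_nonneg hr.1 (by linarith [hr.2])),
    abs_of_nonneg (mul_nonneg hs.1 (by linarith [hs.2]))]
  nlinarith [hr.2, hs.2]

theorem strictAntiOn_bergerCotton_Icc_half_one :
    StrictAntiOn (bergerCotton F) (Icc (1 / 2) 1) := by
  intro r hr s hs hrs
  have h := strictMonoOn_bergerCotton_Icc_zero_half F (a := 1 - s) (b := 1 - r)
    ⟨by linarith [hs.2], by linarith [hs.1]⟩ ⟨by linarith [hr.2], by linarith [hr.1]⟩ (by linarith)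
  simpa only [bergerCotton, sub_sub_cancel, mul_comm r, mul_comm s] using h

theorem strictMonoOn_bergerCotton_Ici_one : StrictMonoOn (bergerCotton F) (Ici 1) := by
  intro r hr s hs hrs
  rw [mem_Ici] at hr hs
  refine mul_lt_mul_of_pos_left ?_ (cottonConst_pos F)
  rw [abs_of_nonpos (mul_nonpos_of_nonneg_of_nonpos (by linarith) (by linarith)),
    abs_of_nonpos (mul_nonpos_of_nonneg_of_nonpos (by linarith) (by linarith))]
  nlinarith

end BergerCotton

/-! ### The Ricci flow of Berger metrics -/

/-- The functions `A`, `B` on `[0, T)` are the coefficients of a Ricci flow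
`A ω¹ ⊗ ω¹ + B (ω² ⊗ ω² + ω³ ⊗ ω³)` of Berger metrics in a Milnor frame that collapses at the
time `T`. -/
structure IsBergerFlow (T : ℝ) (A B : ℝ → ℝ) : Prop where
  time_pos : 0 < T
  fst_pos : ∀ t ∈ Ico 0 T, 0 < A t
  snd_pos : ∀ t ∈ Ico 0 T, 0 < B t
  hasDerivWithinAt_fst :
    ∀ t ∈ Ico 0 T, HasDerivWithinAt A (-4 * (A t / B t) ^ 2) (Ico 0 T) t
  hasDerivWithinAt_snd :
    ∀ t ∈ Ico 0 T, HasDerivWithinAt B (-8 + 4 * (A t / B t)) (Ico 0 T) t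
  tendsto_fst : Tendsto A (𝓝[<] T) (𝓝 0)

/-- The first integral `(1 - A / B) / A ^ 2 = c` determines `B` in terms of `A`. -/
theorem isBergerFlow_of_firstIntegral {T c : ℝ} {A : ℝ → ℝ} (hT : 0 < T)
    (hpos : ∀ t ∈ Ico 0 T, 0 < A t) (hratio : ∀ t ∈ Ico 0 T, 0 < 1 - c * A t ^ 2)
    (hA : ∀ t ∈ Ico 0 T, HasDerivWithinAt A (-4 * (1 - c * A t ^ 2) ^ 2) (Ico 0 T) t)
    (hlim : Tendsto A (𝓝[<] T) (𝓝 0)) :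
    IsBergerFlow T A fun t => A t / (1 - c * A t ^ 2) where
  time_pos := hT
  fst_pos := hpos
  snd_pos t ht := div_pos (hpos t ht) (hratio t ht)
  hasDerivWithinAt_fst t ht := by
    rw [div_div_cancel₀ (hpos t ht).ne']
    exact hA t ht
  hasDerivWithinAt_snd t ht := by
    rw [div_div_cancel₀ (hpos t ht).ne']
    have hne := (hratio t ht).ne'
    refine ((hA t ht).fun_div
      ((((hA t ht).fun_pow 2).const_mul c).const_sub 1) hne).congr_deriv ?_
    field_simp
    ring
  tendsto_fst := hlim

theorem exists_isBergerFlow {a₀ b₀ : ℝ} (ha₀ : 0 < a₀) (hb₀ : 0 < b₀) :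
    ∃ T A B, IsBergerFlow T A B ∧ A 0 = a₀ ∧ B 0 = b₀ := by
  set c := (1 - a₀ / b₀) / a₀ ^ 2 with hc
  have hratio₀ : 1 - c * a₀ ^ 2 = a₀ / b₀ := by
    rw [hc, div_mul_cancel₀ _ (pow_ne_zero 2 ha₀.ne'), sub_sub_cancel]
  have hratio : ∀ s ∈ Icc 0 a₀, 0 < 1 - c * s ^ 2 := by
    intro s hs
    have hle : s ^ 2 ≤ a₀ ^ 2 := pow_le_pow_left₀ hs.1 hs.2 2
    obtain hc' | hc' := le_total c 0
    · nlinarith [sq_nonneg s]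
    · nlinarith [div_pos ha₀ hb₀]
  -- `A` is the time reversal of the solution `y` that starts at `0`.
  obtain ⟨T, hT, y, hy₀, hyT, hmono, hy⟩ :=
    exists_strictMono_hasDerivAt (φ := fun s => 4 * (1 - c * s ^ 2) ^ 2) ha₀ (by fun_prop)
      fun s hs => by have := hratio s hs; positivity
  have hA : ∀ t ∈ Icc 0 T,
      HasDerivAt (fun t => y (T - t)) (-4 * (1 - c * y (T - t) ^ 2) ^ 2) t := fun t ht => by
    have hreverse := (hy (T - t) ⟨sub_nonneg.2 ht.2, sub_le_self T ht.1⟩).comp_const_sub T t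
    simpa only [neg_mul] using hreverse
  have hpos : ∀ t ∈ Ico 0 T, 0 < y (T - t) := fun t ht => hy₀ ▸ hmono (sub_pos.2 ht.2)
  have hle : ∀ t ∈ Ico 0 T, y (T - t) ≤ a₀ := fun t ht =>
    hyT ▸ hmono.monotone (sub_le_self T ht.1)
  have hlim : Tendsto (fun t => y (T - t)) (𝓝 T) (𝓝 0) := by
    have hcont := (hA T ⟨hT.le, le_rfl⟩).continuousAt.tendsto
    rwa [sub_self, hy₀] at hcont
  refine ⟨T, _, _, isBergerFlow_of_firstIntegral hT hpos
    (fun t ht => hratio _ ⟨(hpos t ht).le, hle t ht⟩)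
    (fun t ht => (hA t (Ico_subset_Icc_self ht)).hasDerivWithinAt)
    (hlim.mono_left nhdsWithin_le_nhds), by rw [sub_zero, hyT], ?_⟩
  simp only [sub_zero, hyT, hratio₀, div_div_cancel₀ ha₀.ne']

namespace IsBergerFlow

variable {T : ℝ} {A B : ℝ → ℝ} (h : IsBergerFlow T A B)
include h

theorem zero_mem : (0 : ℝ) ∈ Ico 0 T := ⟨le_rfl, h.time_pos⟩

theorem ratio_pos {t : ℝ} (ht : t ∈ Ico 0 T) : 0 < A t / B t :=
  div_pos (h.fst_pos t ht) (h.snd_pos t ht)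

theorem continuousOn_ratio : ContinuousOn (fun t => A t / B t) (Ico 0 T) :=
  ContinuousOn.div (fun t ht => (h.hasDerivWithinAt_fst t ht).continuousWithinAt)
    (fun t ht => (h.hasDerivWithinAt_snd t ht).continuousWithinAt)
    fun t ht => (h.snd_pos t ht).ne'

theorem strictAntiOn_fst : StrictAntiOn A (Ico 0 T) := by
  refine strictAntiOn_of_hasDerivWithinAt_neg (convex_Ico 0 T)
    (f' := fun t => -4 * (A t / B t) ^ 2)
    (fun t ht => (h.hasDerivWithinAt_fst t ht).continuousWithinAt)
    (fun t ht => (h.hasDerivWithinAt_fst t (interior_subset ht)).mono interior_subset)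
    fun t ht => ?_
  have := h.ratio_pos (interior_subset ht)
  simp only [neg_mul, neg_lt_zero]
  positivity

theorem one_sub_ratio_div_sq {t : ℝ} (ht : t ∈ Ico 0 T) :
    (1 - A t / B t) / A t ^ 2 = (1 - A 0 / B 0) / A 0 ^ 2 := by
  have hderiv : ∀ s ∈ Ico 0 T,
      HasDerivWithinAt (fun s => (1 - A s / B s) / A s ^ 2) 0 (Ico 0 T) s := by
    intro s hs
    have hAne := (h.fst_pos s hs).ne'
    have hBne := (h.snd_pos s hs).ne'
    have hA := h.hasDerivWithinAt_fst s hs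
    have hB := h.hasDerivWithinAt_snd s hs
    refine (((hA.fun_div hB hBne).const_sub 1).fun_div (hA.fun_pow 2)
      (pow_ne_zero 2 hAne)).congr_deriv ?_
    field_simp
    ring
  refine (convex_Ico 0 T).is_const_of_fderivWithin_eq_zero (𝕜 := ℝ)
    (fun s hs => (hderiv s hs).differentiableWithinAt) (fun s hs => ?_) ht h.zero_mem
  rw [(hderiv s hs).hasFDerivWithinAt.fderivWithin (uniqueDiffOn_Ico 0 T s hs)]
  ext
  simp

theorem ratio_eq {t : ℝ} (ht : t ∈ Ico 0 T) :
    A t / B t = 1 - (1 - A 0 / B 0) / A 0 ^ 2 * A t ^ 2 := by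
  rw [← h.one_sub_ratio_div_sq ht, div_mul_cancel₀ _ (pow_ne_zero 2 (h.fst_pos t ht).ne'),
    sub_sub_cancel]

theorem tendsto_ratio : Tendsto (fun t => A t / B t) (𝓝[<] T) (𝓝 1) := by
  have hlim := (h.tendsto_fst.pow 2).const_mul ((1 - A 0 / B 0) / A 0 ^ 2) |>.const_sub 1
  rw [zero_pow two_ne_zero, mul_zero, sub_zero] at hlim
  refine hlim.congr' ?_
  filter_upwards [Ico_mem_nhdsLT h.time_pos] with t ht using (h.ratio_eq ht).symm

theorem strictAntiOn_fst_sq : StrictAntiOn (fun t => A t ^ 2) (Ico 0 T) := fun _ hs t ht hst =>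
  pow_lt_pow_left₀ (h.strictAntiOn_fst hs ht hst) (h.fst_pos t ht).le two_ne_zero

theorem strictMonoOn_ratio (hlt : A 0 / B 0 < 1) :
    StrictMonoOn (fun t => A t / B t) (Ico 0 T) := by
  intro s hs t ht hst
  have hc : 0 < (1 - A 0 / B 0) / A 0 ^ 2 :=
    div_pos (sub_pos.2 hlt) (pow_pos (h.fst_pos 0 h.zero_mem) 2)
  simp only [h.ratio_eq hs, h.ratio_eq ht]
  exact sub_lt_sub_left (mul_lt_mul_of_pos_left (h.strictAntiOn_fst_sq hs ht hst) hc) 1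

theorem strictAntiOn_ratio (hlt : 1 < A 0 / B 0) :
    StrictAntiOn (fun t => A t / B t) (Ico 0 T) := by
  intro s hs t ht hst
  have hc : (1 - A 0 / B 0) / A 0 ^ 2 < 0 :=
    div_neg_of_neg_of_pos (sub_neg.2 hlt) (pow_pos (h.fst_pos 0 h.zero_mem) 2)
  simp only [h.ratio_eq hs, h.ratio_eq ht]
  exact sub_lt_sub_left (mul_lt_mul_of_neg_left (h.strictAntiOn_fst_sq hs ht hst) hc) 1

theorem ratio_lt_one (hlt : A 0 / B 0 < 1) {t : ℝ} (ht : t ∈ Ico 0 T) : A t / B t < 1 := by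
  have hpos := mul_pos (div_pos (sub_pos.2 hlt) (pow_pos (h.fst_pos 0 h.zero_mem) 2))
    (pow_pos (h.fst_pos t ht) 2)
  linarith [h.ratio_eq ht]

theorem one_lt_ratio (hlt : 1 < A 0 / B 0) {t : ℝ} (ht : t ∈ Ico 0 T) : 1 < A t / B t := by
  have hneg := mul_neg_of_neg_of_pos
    (div_neg_of_neg_of_pos (sub_neg.2 hlt) (pow_pos (h.fst_pos 0 h.zero_mem) 2))
    (pow_pos (h.fst_pos t ht) 2)
  linarith [h.ratio_eq ht]

theorem ratio_eq_one (heq : A 0 / B 0 = 1) {t : ℝ} (ht : t ∈ Ico 0 T) : A t / B t = 1 := by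
  rw [h.ratio_eq ht, heq, sub_self, zero_div, zero_mul, sub_zero]

theorem exists_ratio_eq_half (hlt : A 0 / B 0 < 1 / 2) :
    ∃ t₀ ∈ Ioo 0 T, A t₀ / B t₀ = 1 / 2 := by
  have := nhdsLT_neBot T
  obtain ⟨t₀, ht₀, hhalf⟩ := isPreconnected_Ico.intermediate_value_Ico h.zero_mem
    (le_principal_iff.2 (Ico_mem_nhdsLT h.time_pos)) h.continuousOn_ratio h.tendsto_ratio
    ⟨hlt.le, by norm_num⟩
  refine ⟨t₀, ⟨ht₀.1.lt_of_ne ?_, ht₀.2⟩, hhalf⟩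
  rintro rfl
  exact hlt.ne hhalf

section Metric

variable {F : Frame}

theorem exists_isDiagonal (F : Frame) :
    ∃ g : ℝ → RiemannianMetric, ∀ t ∈ Ico 0 T, (g t).IsDiagonal F (A t) (B t) (B t) := by
  have hex : ∀ t ∈ Ico 0 T, ∃ g : RiemannianMetric, g.IsDiagonal F (A t) (B t) (B t) :=
    fun t ht => CottonFlow.exists_isDiagonal F (h.fst_pos t ht) (h.snd_pos t ht) (h.snd_pos t ht)
  have : Nonempty RiemannianMetric := (hex 0 h.zero_mem).nonempty
  choose! g hg using hex
  exact ⟨g, hg⟩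

variable {g : ℝ → RiemannianMetric} (hF : F.IsMilnor)
  (hg : ∀ t ∈ Ico 0 T, (g t).IsDiagonal F (A t) (B t) (B t))
include hF hg

theorem isRicciFlow : IsRicciFlow F T g := by
  refine isRicciFlow_of_leftInvariant (fun t ht => (hg t ht).leftInvariant) fun t ht i j => ?_
  have hA := h.hasDerivWithinAt_fst t ht
  have hB := h.hasDerivWithinAt_snd t ht
  have hdiag : HasDerivWithinAt (fun s => Matrix.diagonal ![A s, B s, B s] i j)
      (-2 * ricci F (g t) i j 1) (Ico 0 T) t := by
    rw [(hg t ht).ricci_eq hF]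
    obtain rfl | hij := eq_or_ne i j
    · simp only [Matrix.diagonal_apply_eq]
      fin_cases i
      exacts [hA.congr_deriv (by simp; ring), hB.congr_deriv (by simp; ring),
        hB.congr_deriv (by simp; ring)]
    · simpa only [Matrix.diagonal_apply_ne _ hij, mul_zero] using
        hasDerivWithinAt_const t (Ico 0 T) (0 : ℝ)
  exact hdiag.congr (fun s hs => by rw [(hg s hs).gram_eq]) (by rw [(hg t ht).gram_eq])

theorem isMaximalRicciFlow : IsMaximalRicciFlow F T g := by
  refine (h.isRicciFlow hF hg).isMaximalRicciFlow_of_tendsto_zero (x := 1) h.time_pos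
    (F.ne_zero 0) (h.tendsto_fst.congr' ?_)
  filter_upwards [Ico_mem_nhdsLT h.time_pos] with t ht
  rw [hg t ht 1, Matrix.diagonal_apply_eq, Matrix.cons_val_zero]

omit h in
theorem eqOn_cottonL1 :
    EqOn (fun t => cottonL1 F (g t)) (fun t => bergerCotton F (A t / B t)) (Ico 0 T) :=
  fun t ht => (hg t ht).cottonL1_eq hF

theorem tendsto_cottonL1 : Tendsto (fun t => cottonL1 F (g t)) (𝓝[<] T) (𝓝 0) := by
  have hlim := ((continuous_bergerCotton F).tendsto 1).comp h.tendsto_ratio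
  rw [bergerCotton_one] at hlim
  refine hlim.congr' ?_
  filter_upwards [Ico_mem_nhdsLT h.time_pos] with t ht using (eqOn_cottonL1 hF hg ht).symm

theorem cottonL1_eq_zero (heq : A 0 / B 0 = 1) {t : ℝ} (ht : t ∈ Ico 0 T) :
    cottonL1 F (g t) = 0 := by
  rw [(hg t ht).cottonL1_eq hF, h.ratio_eq_one heq ht, bergerCotton_one]

theorem strictMonoOn_cottonL1_of_ratio_le_half (hlt : A 0 / B 0 < 1) {s : ℝ} (hs : s ∈ Ico 0 T)
    (hhalf : A s / B s ≤ 1 / 2) : StrictMonoOn (fun t => cottonL1 F (g t)) (Icc 0 s) := by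
  have hsub : Icc 0 s ⊆ Ico 0 T := Icc_subset_Ico_right hs.2
  refine ((strictMonoOn_bergerCotton_Icc_zero_half F).comp
    ((h.strictMonoOn_ratio hlt).mono hsub) fun t ht => ?_).congr
      ((eqOn_cottonL1 hF hg).mono hsub).symm
  exact ⟨(h.ratio_pos (hsub ht)).le,
    ((h.strictMonoOn_ratio hlt).monotoneOn (hsub ht) hs ht.2).trans hhalf⟩

theorem strictAntiOn_cottonL1_of_half_le_ratio (hlt : A 0 / B 0 < 1) {s : ℝ} (hs : s ∈ Ico 0 T)
    (hhalf : 1 / 2 ≤ A s / B s) : StrictAntiOn (fun t => cottonL1 F (g t)) (Ico s T) := by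
  have hsub : Ico s T ⊆ Ico 0 T := Ico_subset_Ico_left hs.1
  refine ((strictAntiOn_bergerCotton_Icc_half_one F).comp_strictMonoOn
    ((h.strictMonoOn_ratio hlt).mono hsub) fun t ht => ?_).congr
      ((eqOn_cottonL1 hF hg).mono hsub).symm
  exact ⟨hhalf.trans ((h.strictMonoOn_ratio hlt).monotoneOn hs (hsub ht) ht.1),
    (h.ratio_lt_one hlt (hsub ht)).le⟩

theorem strictAntiOn_cottonL1_of_one_lt_ratio (hlt : 1 < A 0 / B 0) :
    StrictAntiOn (fun t => cottonL1 F (g t)) (Ico 0 T) :=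
  ((strictMonoOn_bergerCotton_Ici_one F).comp_strictAntiOn (h.strictAntiOn_ratio hlt)
    fun _ ht => (h.one_lt_ratio hlt ht).le).congr (eqOn_cottonL1 hF hg).symm

theorem isLocalExtr_cottonL1_iff (hlt : A 0 / B 0 < 1) {t₀ : ℝ} (ht₀ : t₀ ∈ Ioo 0 T)
    (hhalf : A t₀ / B t₀ = 1 / 2) {t : ℝ} (ht : t ∈ Ioo 0 T) :
    IsLocalExtr (fun s => cottonL1 F (g s)) t ↔ t = t₀ :=
  isLocalExtr_iff_eq_of_strictMonoOn_of_strictAntiOn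
    ((h.strictMonoOn_cottonL1_of_ratio_le_half hF hg hlt (Ioo_subset_Ico_self ht₀) hhalf.le).mono
      Ioc_subset_Icc_self)
    (h.strictAntiOn_cottonL1_of_half_le_ratio hF hg hlt (Ioo_subset_Ico_self ht₀) hhalf.ge) ht

end Metric

end IsBergerFlow

end CottonFlow

end

open CottonFlow in
theorem theorem3p2 (F : Frame) (hF : F.IsMilnor) (g₀ : RiemannianMetric) (A₀ B₀ C₀ : ℝ)
    (hg₀ : g₀.IsDiagonal F A₀ B₀ C₀) (hBC : B₀ = C₀) :
    ∃ (T : ℝ) (g : ℝ → RiemannianMetric) (A B : ℝ → ℝ),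
      0 < T ∧ g 0 = g₀ ∧ IsMaximalRicciFlow F T g ∧
      (∀ t ∈ Set.Ico 0 T, (g t).LeftInvariant ∧ (g t).IsDiagonal F (A t) (B t) (B t)) ∧
      (∀ (T' : ℝ) (g' : ℝ → RiemannianMetric), g' 0 = g₀ → IsRicciFlow F T' g' →
        (∀ t ∈ Set.Ico 0 T', (g' t).LeftInvariant) →
        T' ≤ T ∧ ∀ t ∈ Set.Ico 0 T', g' t = g t) ∧
      (A₀ / B₀ < 1 / 2 →
        (∃ t₀ ∈ Set.Ioo 0 T, (∀ t ∈ Set.Ico 0 T, A t / B t = 1 / 2 ↔ t = t₀) ∧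
          ∀ t ∈ Set.Ioo 0 T, IsLocalExtr (fun s => cottonL1 F (g s)) t ↔ t = t₀) ∧
        Filter.Tendsto (fun t => cottonL1 F (g t)) (nhdsWithin T (Set.Iio T)) (nhds 0)) ∧
      ((1 / 2 ≤ A₀ / B₀ ∧ A₀ / B₀ < 1) ∨ 1 < A₀ / B₀ →
        StrictAntiOn (fun t => cottonL1 F (g t)) (Set.Ico 0 T) ∧
        Filter.Tendsto (fun t => cottonL1 F (g t)) (nhdsWithin T (Set.Iio T)) (nhds 0)) ∧
      (A₀ = B₀ → ∀ t ∈ Set.Ico 0 T, cottonL1 F (g t) = 0) := by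
  subst hBC
  obtain ⟨T, A, B, h, rfl, rfl⟩ := exists_isBergerFlow hg₀.fst_pos hg₀.snd_pos
  obtain ⟨g, hg⟩ := h.exists_isDiagonal F
  have hinit : g 0 = g₀ := (hg 0 h.zero_mem).eq hg₀
  have hinv : ∀ t ∈ Set.Ico 0 T, (g t).LeftInvariant := fun t ht => (hg t ht).leftInvariant
  have hmax : IsMaximalRicciFlow F T g := h.isMaximalRicciFlow hF hg
  refine ⟨T, g, A, B, h.time_pos, hinit, hmax, fun t ht => ⟨hinv t ht, hg t ht⟩,
    fun T' g' h0 hg' hinv' =>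
      hmax.le_and_eqOn_of_leftInvariant hinv hg' hinv' (h0.trans hinit.symm),
    fun hlt => ⟨?_, h.tendsto_cottonL1 hF hg⟩, fun hne => ⟨?_, h.tendsto_cottonL1 hF hg⟩,
    fun heq t ht => h.cottonL1_eq_zero hF hg ?_ ht⟩
  · have hlt_one : A 0 / B 0 < 1 := hlt.trans one_half_lt_one
    obtain ⟨t₀, ht₀, hhalf⟩ := h.exists_ratio_eq_half hlt
    refine ⟨t₀, ht₀, fun t ht => ?_, fun t => h.isLocalExtr_cottonL1_iff hF hg hlt_one ht₀ hhalf⟩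
    rw [← hhalf]
    exact (h.strictMonoOn_ratio hlt_one).injOn.eq_iff ht (Set.Ioo_subset_Ico_self ht₀)
  · obtain ⟨hge, hlt⟩ | hgt := hne
    · exact h.strictAntiOn_cottonL1_of_half_le_ratio hF hg hlt h.zero_mem hge
    · exact h.strictAntiOn_cottonL1_of_one_lt_ratio hF hg hgt
  · rw [heq, div_self hg₀.snd_pos.ne']
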